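/- **Conventions.** Formulas are in the language with $\in$ and $=$ and are in negation normal form: they are built from $s\in t$, $s\notin t$, $s=t$, $s\neq t$ by $\land$, $\lor$, bounded quantifiers $\forall_{x\in t}$, $\exists_{x\in t}$ (separate logical symbols) and unbounded quantifiers $\forall_x$, $\exists_x$; negation $\neg$ is the operation defined by de Morgan's rules, so that $\neg\neg\varphi=\varphi$. A $\Delta_0$-formula is one without unbounded quantifiers. Let $u$ be a transitive set with $\{0,1\}\subseteq u$, where $0=\emptyset$ and $1=\{\emptyset\}$, and let $\alpha$ be an ordinal. **Terms.** The set $\mathbf L^u_\alpha$ of terms $a$, with finite supports $\operatorname{supp}(a)\subseteq\alpha$, is generated as follows: each $v\in u$ is a term with empty support; for $\gamma<\alpha$ there is a term $L^u_\gamma$ with support $\{\gamma\}$; and for $\gamma<\alpha$, a $\Delta_0$-formula $\varphi(x,y_1,\dots,y_n)$ with all free variables displayed, and terms $a_1,\dots,a_n$ all of whose supports consist of ordinals below $\gamma$, there is a term $\{x\in L^u_\gamma\mid\varphi(x,a_1,\dots,a_n)\}$ with support $\{\gamma\}\cup\operatorname{supp}(a_1)\cup\dots\cup\operatorname{supp}(a_n)$.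 For $\gamma<\alpha$ we have $\mathbf L^u_\gamma=\{a\in\mathbf L^u_\alpha\mid\operatorname{supp}(a)\subseteq\gamma\}$. An $\mathbf L^u_\alpha$-formula is a formula with elements of $\mathbf L^u_\alpha$ as parameters (constant symbols). **Interpretation.** By recursion on $\alpha$ one defines $\llbracket\cdot\rrbracket_\alpha$ on $\mathbf L^u_\alpha$ and its image $\mathbb L^u_\alpha$: $\llbracket v\rrbracket_\alpha=v$ for $v\in u$, $\llbracket L^u_\gamma\rrbracket_\alpha=\mathbb L^u_\gamma$, and $\llbracket\{x\in L^u_\gamma\mid\varphi(x,a_1,\dots,a_n)\}\rrbracket_\alpha=\{x\in\mathbb L^u_\gamma\mid\mathbb L^u_\gamma\vDash\varphi(x,\llbracket a_1\rrbracket_\gamma,\dots,\llbracket a_n\rrbracket_\gamma)\}$. For a closed $\mathbf L^u_\alpha$-formula $\varphi$ we write $\mathbb L^u_\alpha\vDash\varphi$ if $\varphi$ holds in $(\mathbb L^u_\alpha,\in)$ when each parameter $a$ is interpreted as $\llbracket a\rrbracket_\alpha$. **Disjunctive and conjunctive formulas.** Certain closed $\mathbf L^u_\alpha$-formulas $\varphi$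 are disjunctive, written $\varphi\simeq\bigvee_{a\in\iota(\varphi)}\varphi_a$, with an index set $\iota(\varphi)\subseteq\mathbf L^u_\alpha$ and closed $\mathbf L^u_\alpha$-formulas $\varphi_a$, according to the following clauses: - for $v\in u$: if $b$ is a term $v'\in u$ with $v'\notin v$, then $b\in v\simeq\bigvee\emptyset$; if $b$ is not an element of $u$, then $b\in v\simeq\bigvee_{a\in\{v'\in u\mid v'\in v\}}a=b$; if $b$ is a term $v'\in u$ with $v'\in v$, then $b\notin v\simeq\bigvee\emptyset$; - $b\in L^u_\gamma\simeq\bigvee_{a\in\mathbf L^u_\gamma}a=b$; - $b\in\{x\in L^u_\gamma\mid\varphi(x,\vec c)\}\simeq\bigvee_{a\in\mathbf L^u_\gamma}(\varphi(a,\vec c)\land a=b)$; - $b_0\neq b_1\simeq\bigvee_{a\in\{0,1\}}\exists_{x\in b_a}x\notin b_{1-a}$; - $\psi_0\lor\psi_1\simeq\bigvee_{a\in\{0,1\}}\psi_a$; - $\exists_{x\in v}\psi(x)\simeq\bigvee_{a\in\{v'\in u\mid v'\in v\}}\psi(a)$ for $v\in u$, $\ \exists_{x\in L^u_\gamma}\psi(x)\simeq\bigvee_{a\in\mathbf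 L^u_\gamma}\psi(a)$, $\ \exists_{x\in b}\psi(x)\simeq\bigvee_{a\in\mathbf L^u_\gamma}(\varphi(a,\vec c)\land\psi(a))$ for $b=\{y\in L^u_\gamma\mid\varphi(y,\vec c)\}$; - $\exists_x\psi(x)\simeq\bigvee_{a\in\mathbf L^u_\alpha}\psi(a)$. For each closed formula $\varphi$, exactly one of $\varphi$ and $\neg\varphi$ is disjunctive. If $\varphi\simeq\bigvee_{a\in\iota(\varphi)}\varphi_a$ is disjunctive, then $\neg\varphi$ is conjunctive, written $\neg\varphi\simeq\bigwedge_{a\in\iota(\varphi)}\neg(\varphi_a)$, i.e. $\iota(\neg\varphi)=\iota(\varphi)$ and $(\neg\varphi)_a=\neg(\varphi_a)$. **Theorem.** Let $u\supseteq\{0,1\}$ be a transitive set and let $\alpha$ be an ordinal. Assume that $F$ is a set of closed $\mathbf L^u_\alpha$-formulas with the following properties: - If $F$ contains a conjunctive formula $\varphi\simeq\bigwedge_{a\in\iota(\varphi)}\varphi_a$, then it contains $\varphi_a$ for some $a\in\iota(\varphi)$. - If $F$ contains a disjunctive formula $\varphi\simeq\bigvee_{a\in\iota(\varphi)}\varphi_a$,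 then it contains $\varphi_a$ for all $a\in\iota(\varphi)$. Then $\mathbb L^u_\alpha\nvDash\varphi$ for every formula $\varphi\in F$. -/

import Mathlib

universe v w

namespace ConstructibleTerms

/-! ### Set-theoretic formulas in negation normal form -/

/-- Arguments of prime formulas and bounds of quantifiers, with free variables among `n` variables:
one of the variables `0, …, n - 1` (which exist for `n > 0` only), or a constant from `C`. -/
inductive Arg (C : Type w) : ℕ → Type w
  | var {n : ℕ} (i : Fin (n + 1)) : Arg C (n + 1)
  | const {n : ℕ} (c : C) : Arg C n

/-- Formulas in negation normal form, in the language with relation symbols `∈` and `=`,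
with constant symbols from `C` and with free variables among the `n` variables `0, …, n - 1`.
Bounded quantifiers are separate symbols. A quantifier turns the variable with the largest
number, i.e. the variable `n` of a formula in `Formula C (n + 1)`, into a bound variable. -/
inductive Formula (C : Type w) : ℕ → Type w
  | mem {n : ℕ} (s t : Arg C n) : Formula C n
  | notMem {n : ℕ} (s t : Arg C n) : Formula C n
  | eq {n : ℕ} (s t : Arg C n) : Formula C n
  | ne {n : ℕ} (s t : Arg C n) : Formula C n
  | and {n : ℕ} (φ ψ : Formula C n) : Formula C n
  | or {n : ℕ} (φ ψ : Formula C n) : Formula C n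
  | allIn {n : ℕ} (t : Arg C n) (φ : Formula C (n + 1)) : Formula C n
  | exIn {n : ℕ} (t : Arg C n) (φ : Formula C (n + 1)) : Formula C n
  | all {n : ℕ} (φ : Formula C (n + 1)) : Formula C n
  | ex {n : ℕ} (φ : Formula C (n + 1)) : Formula C n

/-- The set of constants that occur in an argument (empty or a singleton). -/
def Arg.consts {C : Type w} {n : ℕ} : Arg C n → Set C
  | .var _ => ∅
  | .const c => {c}

/-- The constant that an argument without free variables consists of. -/
def Arg.get {C : Type w} : Arg C 0 → C
  | .const c => c

/-- The variable with number `i`. -/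
def Arg.ofFin {C : Type w} : {n : ℕ} → Fin n → Arg C n
  | _ + 1, i => .var i

/-- Replace the variable `0` by the constant `c` (and renumber the other variables). -/
def Arg.inst {C : Type w} {n : ℕ} (c : C) : Arg C (n + 1) → Arg C n
  | .var i => Fin.cases (motive := fun _ => Arg C n) (.const c) Arg.ofFin i
  | .const d => .const d

/-- The value of an argument, for given interpretations of constants and variables. -/
def Arg.eval {C : Type w} (val : C → ZFSet.{v}) :
    {n : ℕ} → (Fin n → ZFSet.{v}) → Arg C n → ZFSet.{v}
  | _, e, .var i => e i
  | _, _, .const c => val c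

namespace Formula

variable {C : Type w}

/-- Negation, as a defined operation on negation normal forms. -/
def neg {n : ℕ} : Formula C n → Formula C n
  | mem s t => notMem s t
  | notMem s t => mem s t
  | eq s t => ne s t
  | ne s t => eq s t
  | and φ ψ => or φ.neg ψ.neg
  | or φ ψ => and φ.neg ψ.neg
  | allIn t φ => exIn t φ.neg
  | exIn t φ => allIn t φ.neg
  | all φ => ex φ.neg
  | ex φ => all φ.neg

/-- Bounded formulas (`Δ₀`-formulas), i.e. formulas without unbounded quantifiers. -/
def IsBounded {n : ℕ} : Formula C n → Prop
  | mem _ _ => True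
  | notMem _ _ => True
  | eq _ _ => True
  | ne _ _ => True
  | and φ ψ => φ.IsBounded ∧ ψ.IsBounded
  | or φ ψ => φ.IsBounded ∧ ψ.IsBounded
  | allIn _ φ => φ.IsBounded
  | exIn _ φ => φ.IsBounded
  | all _ => False
  | ex _ => False

/-- The set of constants (parameters) that occur in a formula. -/
def consts {n : ℕ} : Formula C n → Set C
  | mem s t => s.consts ∪ t.consts
  | notMem s t => s.consts ∪ t.consts
  | eq s t => s.consts ∪ t.consts
  | ne s t => s.consts ∪ t.consts
  | and φ ψ => φ.consts ∪ ψ.consts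
  | or φ ψ => φ.consts ∪ ψ.consts
  | allIn t φ => t.consts ∪ φ.consts
  | exIn t φ => t.consts ∪ φ.consts
  | all φ => φ.consts
  | ex φ => φ.consts

/-- Substitute the constant `c` for the variable `0` (and renumber the other variables). In
particular this is the substitution `φ(c)` in a formula `φ = φ(x)` with a single free variable. -/
def inst (c : C) : {n : ℕ} → Formula C (n + 1) → Formula C n
  | _, mem s t => mem (s.inst c) (t.inst c)
  | _, notMem s t => notMem (s.inst c) (t.inst c)
  | _, eq s t => eq (s.inst c) (t.inst c)
  | _, ne s t => ne (s.inst c) (t.inst c)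
  | _, and φ ψ => and (φ.inst c) (ψ.inst c)
  | _, or φ ψ => or (φ.inst c) (ψ.inst c)
  | _, allIn t φ => allIn (t.inst c) (φ.inst c)
  | _, exIn t φ => exIn (t.inst c) (φ.inst c)
  | _, all φ => all (φ.inst c)
  | _, ex φ => ex (φ.inst c)

/-- Satisfaction of a formula in the structure `(M, ∈)`, when constants are interpreted according
to `val` and the free variables are interpreted according to `e`. -/
def Sat (M : ZFSet.{v}) (val : C → ZFSet.{v}) : {n : ℕ} → Formula C n → (Fin n → ZFSet.{v}) → Prop
  | _, mem s t, e => s.eval val e ∈ t.eval val e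
  | _, notMem s t, e => s.eval val e ∉ t.eval val e
  | _, eq s t, e => s.eval val e = t.eval val e
  | _, ne s t, e => s.eval val e ≠ t.eval val e
  | _, and φ ψ, e => φ.Sat M val e ∧ ψ.Sat M val e
  | _, or φ ψ, e => φ.Sat M val e ∨ ψ.Sat M val e
  | _, allIn t φ, e => ∀ x ∈ M, x ∈ t.eval val e → φ.Sat M val (Fin.snoc (α := fun _ => ZFSet.{v}) e x)
  | _, exIn t φ, e => ∃ x ∈ M, x ∈ t.eval val e ∧ φ.Sat M val (Fin.snoc (α := fun _ => ZFSet.{v}) e x)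
  | _, all φ, e => ∀ x ∈ M, φ.Sat M val (Fin.snoc (α := fun _ => ZFSet.{v}) e x)
  | _, ex φ, e => ∃ x ∈ M, φ.Sat M val (Fin.snoc (α := fun _ => ZFSet.{v}) e x)

end Formula

/-! ### The term systems -/

/-- Raw terms: names `v` for sets, terms `L_s`, and terms `{x ∈ L_s | φ(x)}` where `φ` may contain
raw terms as parameters. The conditions on `v`, `s` and `φ` are imposed in `IsTerm`. -/
inductive RawTerm (X : Type w) : Type (max (v + 1) w)
  | base (a : ZFSet.{v}) : RawTerm X
  | level (s : X) : RawTerm X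
  | sep (s : X) (φ : Formula (RawTerm X) 1) : RawTerm X

/-- `InSupp s a` means that `s` lies in the support of the term `a`: the support of `v ∈ u` is
empty, that of `L_s` is `{s}`, and that of `{x ∈ L_s | φ(x, a₁, …, aₙ)}` consists of `s` and the
elements of the supports of the parameters `a₁, …, aₙ`. -/
inductive InSupp {X : Type w} : X → RawTerm.{v, w} X → Prop
  | level (s : X) : InSupp s (.level s)
  | sep (s : X) (φ : Formula (RawTerm.{v, w} X) 1) : InSupp s (.sep s φ)
  | param (s t : X) (φ : Formula (RawTerm.{v, w} X) 1) (c : RawTerm.{v, w} X) (hc : c ∈ φ.consts)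
      (h : InSupp t c) : InSupp t (.sep s φ)

/-- The support of a term. -/
def supp {X : Type w} (a : RawTerm.{v, w} X) : Set X := {s | InSupp s a}

/-- The terms in `𝐋^u_S`, for a set `u` and a linear order `S`. For flexibility the linear order is
given as a suborder `S` of a linear order `X`. -/
inductive IsTerm {X : Type w} [LinearOrder X] (u : ZFSet.{v}) (S : Set X) : RawTerm.{v, w} X → Prop
  | base (a : ZFSet.{v}) (ha : a ∈ u) : IsTerm u S (.base a)
  | level (s : X) (hs : s ∈ S) : IsTerm u S (.level s)
  | sep (s : X) (hs : s ∈ S) (φ : Formula (RawTerm.{v, w} X) 1) (hφ : φ.IsBounded)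
      (hc : ∀ c, c ∈ φ.consts → IsTerm u S c)
      (hlt : ∀ c, c ∈ φ.consts → ∀ t ∈ supp c, t < s) : IsTerm u S (.sep s φ)

/-- The term system `𝐋^u_S`. -/
def terms {X : Type w} [LinearOrder X] (u : ZFSet.{v}) (S : Set X) : Set (RawTerm.{v, w} X) :=
  {a | IsTerm u S a}

/-- The set of closed `𝐋^u_S`-formulas, i.e. of closed formulas with parameters from `𝐋^u_S`. -/
def closedFormulas {X : Type w} [LinearOrder X] (u : ZFSet.{v}) (S : Set X) :
    Set (Formula (RawTerm.{v, w} X) 0) :=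
  {φ | φ.consts ⊆ terms u S}

/-! ### Interpretation in the constructible hierarchy

An ordinal `α` is identified with the linear order `Set.Iio α` of its predecessors. -/

open Classical in
/-- The set with the same elements as a small class `A` (and the empty set if `A` is not small). -/
noncomputable def ofClass (A : Set ZFSet.{v}) : ZFSet.{v} :=
  if _ : Small.{v} A then ZFSet.range (fun x : A => (x : ZFSet.{v})) else ∅

open Classical in
/-- The interpretation `⟦a⟧_α` of terms `a ∈ 𝐋^u_α`, by recursion on `α`. In the clauses for `L_γ`
and `{x ∈ L_γ | φ(x)}` the set `ofClass (interp u γ '' terms u (Set.Iio γ))` is the stage `𝕃^u_γ`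
of the constructible hierarchy (see `stage` and `mem_stage` below). The value `∅` for `¬ γ < α`
is irrelevant, as the given term does not lie in `𝐋^u_α` in this case. -/
noncomputable def interp (u : ZFSet.{v}) (α : Ordinal.{v}) :
    RawTerm.{v, v + 1} Ordinal.{v} → ZFSet.{v}
  | .base a => a
  | .level γ => if _ : γ < α then ofClass (interp u γ '' terms u (Set.Iio γ)) else ∅
  | .sep γ φ =>
      if _ : γ < α then
        ZFSet.sep
          (fun x => φ.Sat (ofClass (interp u γ '' terms u (Set.Iio γ))) (interp u γ) (fun _ => x))
          (ofClass (interp u γ '' terms u (Set.Iio γ)))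
      else ∅
termination_by α

/-- The stage `𝕃^u_α` of the constructible hierarchy over `u`: the image of `⟦·⟧_α` on `𝐋^u_α`. -/
noncomputable def stage (u : ZFSet.{v}) (α : Ordinal.{v}) : ZFSet.{v} :=
  ofClass (interp u α '' terms u (Set.Iio α))

theorem interp_base (u : ZFSet.{v}) (α : Ordinal.{v}) (a : ZFSet.{v}) :
    interp u α (.base a) = a := by
  rw [interp]

theorem interp_level (u : ZFSet.{v}) {γ α : Ordinal.{v}} (h : γ < α) :
    interp u α (.level γ) = stage u γ := by
  rw [interp, dif_pos h, stage]

theorem interp_sep (u : ZFSet.{v}) {γ α : Ordinal.{v}} (h : γ < α)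
    (φ : Formula (RawTerm.{v, v + 1} Ordinal.{v}) 1) :
    interp u α (.sep γ φ) =
      ZFSet.sep (fun x => φ.Sat (stage u γ) (interp u γ) (fun _ => x)) (stage u γ) := by
  rw [interp, dif_pos h, stage]

/-- The image of `⟦·⟧_α` is always small, so that `stage u α` really is this image. -/
theorem small_interp_image (u : ZFSet.{v}) (α : Ordinal.{v}) :
    Small.{v} (interp u α '' terms u (Set.Iio α)) := by
  let B : ZFSet.{v} := u ∪ ZFSet.iUnion fun γ : Set.Iio α => (stage u γ).powerset
  have hB : Small.{v} (B : Set ZFSet.{v}) := ZFSet.small_coe B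
  refine small_subset (s := (B : Set ZFSet.{v})) ?_
  rintro _ ⟨a, ha, rfl⟩
  refine ZFSet.mem_union.2 ?_
  cases ha with
  | base a ha => left; rw [interp_base]; exact ha
  | level γ hγ =>
    right
    rw [interp_level u hγ]
    exact ZFSet.mem_iUnion.2 ⟨⟨γ, hγ⟩, ZFSet.mem_powerset.2 fun _ h => h⟩
  | sep γ hγ φ =>
    right
    rw [interp_sep u hγ]
    exact ZFSet.mem_iUnion.2 ⟨⟨γ, hγ⟩, ZFSet.mem_powerset.2 ZFSet.sep_subset⟩

theorem mem_stage (u : ZFSet.{v}) (α : Ordinal.{v}) (x : ZFSet.{v}) :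
    x ∈ stage u α ↔ ∃ a ∈ terms u (Set.Iio α), interp u α a = x := by
  have := small_interp_image u α
  rw [stage, ofClass, dif_pos this, ZFSet.mem_range]
  simp

/-- `𝕃^u_α ⊨ φ` for a closed `𝐋^u_α`-formula `φ`, where each constant `a` is interpreted by
`⟦a⟧_α`. -/
def Holds (u : ZFSet.{v}) (α : Ordinal.{v}) (φ : Formula (RawTerm.{v, v + 1} Ordinal.{v}) 0) :
    Prop :=
  φ.Sat (stage u α) (interp u α) Fin.elim0

/-! ### The infinitary verification calculus -/

/-- A family of closed formulas, indexed by a set of terms (values of `component` outside of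
`index` are irrelevant). -/
structure Family (X : Type w) where
  index : Set (RawTerm.{v, w} X)
  component : RawTerm.{v, w} X → Formula (RawTerm.{v, w} X) 0

section calculus

variable {X : Type w} [LinearOrder X] (u : ZFSet.{v}) (S : Set X)

/-- The set of terms `a ∈ 𝐋^u_S` with `supp(a) <^fin s`. -/
def termsBelow (s : X) : Set (RawTerm.{v, w} X) := {a ∈ terms u S | ∀ t ∈ supp a, t < s}

/-- The set of terms `v' ∈ u` with `v' ∈ y`. -/
def baseTerms (y : ZFSet.{v}) : Set (RawTerm.{v, w} X) := {a | ∃ z ∈ u, z ∈ y ∧ a = .base z}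

/-- The empty disjunction. -/
def emptyFamily : Family.{v, w} X :=
  ⟨∅, fun a => .eq (.const a) (.const a)⟩

open Classical in
/-- A family indexed by (the terms for) the elements `0 = ∅` and `1 = {∅}` of `u`. -/
noncomputable def binaryFamily (φ₀ φ₁ : Formula (RawTerm.{v, w} X) 0) : Family.{v, w} X :=
  ⟨{.base ∅, .base {∅}}, fun a => if a = .base ∅ then φ₀ else φ₁⟩

open Classical in
/-- The clauses for `b ∈ c`; the value is `none` if the formula is not disjunctive. -/
noncomputable def memClause (b : RawTerm.{v, w} X) : RawTerm.{v, w} X → Option (Family.{v, w} X)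
  | .base y =>
      match b with
      | .base z => if z ∈ y then none else some emptyFamily
      | .level _ => some ⟨baseTerms u y, fun a => .eq (.const a) (.const b)⟩
      | .sep _ _ => some ⟨baseTerms u y, fun a => .eq (.const a) (.const b)⟩
  | .level s => some ⟨termsBelow u S s, fun a => .eq (.const a) (.const b)⟩
  | .sep s φ => some ⟨termsBelow u S s, fun a => .and (φ.inst a) (.eq (.const a) (.const b))⟩

open Classical in
/-- The clauses for `b ∉ c`; the value is `none` if the formula is not disjunctive. -/
noncomputable def notMemClause : RawTerm.{v, w} X → RawTerm.{v, w} X → Option (Family.{v, w} X)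
  | .base z, .base y => if z ∈ y then some emptyFamily else none
  | _, _ => none

/-- The clauses for `∃ x ∈ b, ψ(x)`. -/
def exInClause (ψ : Formula (RawTerm.{v, w} X) 1) : RawTerm.{v, w} X → Family.{v, w} X
  | .base y => ⟨baseTerms u y, fun a => ψ.inst a⟩
  | .level s => ⟨termsBelow u S s, fun a => ψ.inst a⟩
  | .sep s φ => ⟨termsBelow u S s, fun a => .and (φ.inst a) (ψ.inst a)⟩

/-- The disjunctive clauses: `disjunction u S φ = some ⟨I, f⟩` means that `φ` is disjunctive with
`φ ≃ ⋁_{a ∈ I} f a`, and `disjunction u S φ = none` means that `φ` is not disjunctive. -/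
noncomputable def disjunction : Formula (RawTerm.{v, w} X) 0 → Option (Family.{v, w} X)
  | .mem b c => memClause u S b.get c.get
  | .notMem b c => notMemClause b.get c.get
  | .eq _ _ => none
  | .ne b₀ b₁ => some <| binaryFamily
      (.exIn (.const b₀.get) (.notMem (.var 0) (.const b₁.get)))
      (.exIn (.const b₁.get) (.notMem (.var 0) (.const b₀.get)))
  | .and _ _ => none
  | .or ψ₀ ψ₁ => some (binaryFamily ψ₀ ψ₁)
  | .allIn _ _ => none
  | .exIn b ψ => some (exInClause u S ψ b.get)
  | .all _ => none
  | .ex ψ => some ⟨terms u S, fun a => ψ.inst a⟩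

/-- The conjunctive clauses, which arise from the disjunctive ones by duality: we have
`¬φ ≃ ⋀_{a ∈ I} ¬φ_a` if `φ ≃ ⋁_{a ∈ I} φ_a`. -/
noncomputable def conjunction (φ : Formula (RawTerm.{v, w} X) 0) : Option (Family.{v, w} X) :=
  (disjunction u S φ.neg).map fun f => ⟨f.index, fun a => (f.component a).neg⟩

/-- Each closed formula is either disjunctive or conjunctive, but not both. -/
theorem conjunction_isSome_iff (φ : Formula (RawTerm.{v, w} X) 0) :
    (conjunction u S φ).isSome ↔ disjunction u S φ = none := by
  have key : ∀ b c : RawTerm.{v, w} X,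
      ((notMemClause b c).isSome ↔ memClause u S b c = none) ∧
      ((memClause u S b c).isSome ↔ notMemClause b c = none) := by
    intro b c
    cases b <;> cases c <;> simp only [memClause, notMemClause] <;> (try split_ifs) <;> simp
  cases φ <;> simp [conjunction, Formula.neg, disjunction, (key _ _).1, (key _ _).2]

end calculus

end ConstructibleTerms

namespace ConstructibleTerms

open Ordinal

/-! ### Semantics: negation, substitution, change of interpretation, absoluteness -/

section semantics

variable {C : Type w} {val val' : C → ZFSet.{v}} {M M' : ZFSet.{v}}

/-! A disjunctive formula is true exactly if some component is (`disjunction_correct`), and dually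
for conjunctive formulas. Components have smaller ordinal rank (`rank_component_lt`), and the rank
ignores negation. A true formula in `F` thus yields a true component in `F` of smaller rank: in the
disjunctive case some component is true and all lie in `F`, in the conjunctive case all are true and
some lies in `F`. Induction on the rank excludes this.

Correctness uses that the value of a term does not depend on the stage in which it is computed, that
stages are transitive, and that Δ₀-formulas are absolute: a separation term at level `γ` evaluates
its formula in stage `γ`, whereas the component `φ(a)` is evaluated in stage `α`.

The delicate point is the rank, since unfolding runs in a circle: memberships lead to equations,
(in)equations to bounded quantifiers, and these back to (non-)memberships. Term heights are
multiplied by `ω`, which leaves room for finite syntactic increments. A membership costs `ω * γ` for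
the height `γ` of its right side, and `ω * β + 5` only if a left side of height `β > 0` dominates.
Bound variables count as height 0, so a dominant left side costs nothing until a term is
substituted; that term lies below the bound of its quantifier, and the increase stays below `ω`
times the height of this bound. -/

theorem Arg.eval_get (val : C → ZFSet.{v}) (e : Fin 0 → ZFSet.{v}) (s : Arg C 0) :
    s.eval val e = val s.get := by
  cases s; rfl

theorem Arg.get_mem_consts (s : Arg C 0) : s.get ∈ s.consts := by
  cases s; rfl

theorem Arg.eval_ofFin (val : C → ZFSet.{v}) {n : ℕ} (e : Fin n → ZFSet.{v}) (i : Fin n) :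
    (Arg.ofFin i : Arg C n).eval val e = e i := by
  cases n with
  | zero => exact i.elim0
  | succ n => rfl

theorem Arg.eval_inst (val : C → ZFSet.{v}) (c : C) {n : ℕ} (s : Arg C (n + 1))
    (e : Fin n → ZFSet.{v}) :
    (s.inst c).eval val e = s.eval val (Fin.cons (α := fun _ => ZFSet.{v}) (val c) e) := by
  cases s with
  | const d => rfl
  | var i =>
    refine Fin.cases ?_ (fun j => ?_) i
    · rfl
    · exact Arg.eval_ofFin val e j

theorem Arg.eval_congr {n : ℕ} (s : Arg C n) (h : ∀ c ∈ s.consts, val c = val' c)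
    (e : Fin n → ZFSet.{v}) : s.eval val e = s.eval val' e := by
  cases s with
  | var i => rfl
  | const c => exact h c rfl

theorem Arg.eval_mem {n : ℕ} (s : Arg C n) (h : ∀ c ∈ s.consts, val c ∈ M)
    {e : Fin n → ZFSet.{v}} (he : ∀ i, e i ∈ M) : s.eval val e ∈ M := by
  cases s with
  | var i => exact he i
  | const c => exact h c rfl

namespace Formula

theorem consts_neg {n : ℕ} (φ : Formula C n) : φ.neg.consts = φ.consts := by
  induction φ <;> simp_all [neg, consts]

theorem sat_neg {n : ℕ} (φ : Formula C n) (e : Fin n → ZFSet.{v}) :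
    φ.neg.Sat M val e ↔ ¬ φ.Sat M val e := by
  induction φ <;> simp_all [neg, Sat, imp_iff_not_or]

theorem sat_inst (c : C) : ∀ {n : ℕ} (φ : Formula C (n + 1)) (e : Fin n → ZFSet.{v}),
    (φ.inst c).Sat M val e ↔ φ.Sat M val (Fin.cons (α := fun _ => ZFSet.{v}) (val c) e)
  | _, mem s t, e => by simp only [inst, Sat, Arg.eval_inst]
  | _, notMem s t, e => by simp only [inst, Sat, Arg.eval_inst]
  | _, eq s t, e => by simp only [inst, Sat, Arg.eval_inst]
  | _, ne s t, e => by simp only [inst, Sat, Arg.eval_inst]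
  | _, and φ ψ, e => by simp only [inst, Sat, sat_inst c φ, sat_inst c ψ]
  | _, or φ ψ, e => by simp only [inst, Sat, sat_inst c φ, sat_inst c ψ]
  | _, allIn t φ, e => by
    simp only [inst, Sat, sat_inst c φ, Arg.eval_inst, Fin.cons_snoc_eq_snoc_cons]
  | _, exIn t φ, e => by
    simp only [inst, Sat, sat_inst c φ, Arg.eval_inst, Fin.cons_snoc_eq_snoc_cons]
  | _, all φ, e => by simp only [inst, Sat, sat_inst c φ, Fin.cons_snoc_eq_snoc_cons]
  | _, ex φ, e => by simp only [inst, Sat, sat_inst c φ, Fin.cons_snoc_eq_snoc_cons]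

theorem snoc_elim0 (x : ZFSet.{v}) :
    Fin.snoc (α := fun _ => ZFSet.{v}) (Fin.elim0 : Fin 0 → ZFSet.{v}) x = fun _ => x := by
  funext i
  rw [Fin.fin_one_eq_zero i]; rfl

theorem sat_inst_closed (c : C) (φ : Formula C 1) :
    (φ.inst c).Sat M val Fin.elim0 ↔ φ.Sat M val (fun _ => val c) := by
  rw [sat_inst]
  refine iff_of_eq (congrArg _ ?_)
  funext i
  rw [Fin.fin_one_eq_zero i]; rfl

theorem sat_congr {n : ℕ} (φ : Formula C n) (h : ∀ c ∈ φ.consts, val c = val' c)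
    (e : Fin n → ZFSet.{v}) : φ.Sat M val e ↔ φ.Sat M val' e := by
  induction φ with
  | mem s t | notMem s t | eq s t | ne s t =>
    simp only [Sat, s.eval_congr (fun c hc => h c (Or.inl hc)),
      t.eval_congr (fun c hc => h c (Or.inr hc))]
  | and φ ψ ih₁ ih₂ | or φ ψ ih₁ ih₂ =>
    simp only [Sat, ih₁ (fun c hc => h c (Or.inl hc)), ih₂ (fun c hc => h c (Or.inr hc))]
  | allIn t φ ih | exIn t φ ih =>
    simp only [Sat, t.eval_congr (fun c hc => h c (Or.inl hc)), ih (fun c hc => h c (Or.inr hc))]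
  | all φ ih | ex φ ih => simp only [Sat, ih h]

theorem snoc_mem {n : ℕ} {e : Fin n → ZFSet.{v}} (he : ∀ i, e i ∈ M) {x : ZFSet.{v}}
    (hx : x ∈ M) (i : Fin (n + 1)) : Fin.snoc (α := fun _ => ZFSet.{v}) e x i ∈ M := by
  refine Fin.lastCases ?_ (fun j => ?_) i
  · rwa [Fin.snoc_last]
  · rw [Fin.snoc_castSucc]; exact he j

/-- Bounded formulas are absolute between a transitive set and its supersets. -/
theorem sat_absolute (hM : M.IsTransitive) (hMM' : M ⊆ M') {n : ℕ} (φ : Formula C n)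
    (hφ : φ.IsBounded) (hc : ∀ c ∈ φ.consts, val c ∈ M) (e : Fin n → ZFSet.{v})
    (he : ∀ i, e i ∈ M) : φ.Sat M val e ↔ φ.Sat M' val e := by
  induction φ with
  | mem s t | notMem s t | eq s t | ne s t => rfl
  | and φ ψ ih₁ ih₂ | or φ ψ ih₁ ih₂ =>
    simp only [Sat, ih₁ hφ.1 (fun c h => hc c (Or.inl h)) e he,
      ih₂ hφ.2 (fun c h => hc c (Or.inr h)) e he]
  | allIn t φ ih =>
    have ht := t.eval_mem (fun c h => hc c (Or.inl h)) he
    have ih' := fun x (hx : x ∈ M) => ih hφ (fun c h => hc c (Or.inr h)) _ (snoc_mem he hx)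
    -- The value of the bound lies in `M`, so by transitivity its elements do too: both quantifiers
    -- have the same range.
    exact ⟨fun H x _ hxt => (ih' x (hM.mem_trans hxt ht)).1 (H x (hM.mem_trans hxt ht) hxt),
      fun H x hx hxt => (ih' x hx).2 (H x (hMM' hx) hxt)⟩
  | exIn t φ ih =>
    have ht := t.eval_mem (fun c h => hc c (Or.inl h)) he
    have ih' := fun x (hx : x ∈ M) => ih hφ (fun c h => hc c (Or.inr h)) _ (snoc_mem he hx)
    exact ⟨fun ⟨x, hx, hxt, H⟩ => ⟨x, hMM' hx, hxt, (ih' x hx).1 H⟩,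
      fun ⟨x, _, hxt, H⟩ => ⟨x, hM.mem_trans hxt ht, hxt, (ih' x (hM.mem_trans hxt ht)).2 H⟩⟩
  | all φ ih | ex φ ih => exact hφ.elim

end Formula

end semantics

/-! ### Terms and stages -/

section stages

theorem IsTerm.of_supp_subset {X : Type w} [LinearOrder X] {u : ZFSet.{v}} {S T : Set X}
    {a : RawTerm.{v, w} X} (ha : IsTerm u S a) (h : supp a ⊆ T) : IsTerm u T a := by
  induction ha with
  | base a ha => exact .base a ha
  | level s hs => exact .level s (h (.level s))
  | sep s hs φ hφ hc hlt ih =>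
    exact .sep s (h (.sep s φ)) φ hφ
      (fun c hcφ => ih c hcφ fun t ht => h (.param s t φ c hcφ ht)) hlt

theorem IsTerm.supp_subset {X : Type w} [LinearOrder X] {u : ZFSet.{v}} {S : Set X}
    {a : RawTerm.{v, w} X} (ha : IsTerm u S a) : supp a ⊆ S := by
  induction ha with
  | base a ha => rintro t ⟨⟩
  | level s hs => rintro t ⟨⟩; exact hs
  | sep s hs φ hφ hc hlt ih =>
    intro t ht
    cases ht with
    | sep => exact hs
    | param _ _ _ c hcφ h => exact ih c hcφ h

variable {u : ZFSet.{v}} {γ α : Ordinal.{v}}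

theorem terms_mono (h : γ ≤ α) : terms u (Set.Iio γ) ⊆ terms u (Set.Iio α) :=
  fun _ ha => ha.of_supp_subset fun _ ht => lt_of_lt_of_le (ha.supp_subset ht) h

theorem termsBelow_eq (h : γ ≤ α) : termsBelow u (Set.Iio α) γ = terms u (Set.Iio γ) :=
  Set.ext fun _ => ⟨fun ha => ha.1.of_supp_subset ha.2,
    fun ha => ⟨terms_mono h ha, ha.supp_subset⟩⟩

/-- No induction is needed: each clause of `interp` refers only to the index of the term, not to the
ambient ordinal. -/
theorem interp_eq_of_le (h : γ ≤ α) {a : RawTerm.{v, v + 1} Ordinal.{v}}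
    (ha : a ∈ terms u (Set.Iio γ)) : interp u α a = interp u γ a := by
  cases ha with
  | base a ha => rw [interp_base, interp_base]
  | level s hs => rw [interp_level u hs, interp_level u (lt_of_lt_of_le hs h)]
  | sep s hs φ => rw [interp_sep u hs, interp_sep u (lt_of_lt_of_le hs h)]

theorem interp_mem_stage {a : RawTerm.{v, v + 1} Ordinal.{v}} (ha : a ∈ terms u (Set.Iio α)) :
    interp u α a ∈ stage u α :=
  (mem_stage u α _).2 ⟨a, ha, rfl⟩

theorem stage_mono (h : γ ≤ α) : stage u γ ⊆ stage u α := by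
  intro x hx
  obtain ⟨a, ha, rfl⟩ := (mem_stage u γ x).1 hx
  rw [← interp_eq_of_le h ha]
  exact interp_mem_stage (terms_mono h ha)

theorem isTransitive_stage (hu : u.IsTransitive) (α : Ordinal.{v}) :
    (stage u α).IsTransitive := by
  intro y hy x hx
  obtain ⟨a, ha, rfl⟩ := (mem_stage u α y).1 hy
  cases ha with
  | base a ha =>
    rw [interp_base] at hx
    exact (mem_stage u α x).2 ⟨.base x, .base x (hu.mem_trans hx ha), interp_base u α x⟩
  | level s hs =>
    rw [interp_level u hs] at hx
    exact stage_mono (le_of_lt hs) hx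
  | sep s hs φ =>
    rw [interp_sep u hs, ZFSet.mem_sep] at hx
    exact stage_mono (le_of_lt hs) hx.1

/-- Transitivity of `u` ensures that every element of `y` has a name. -/
theorem exists_base_iff (hu : u.IsTransitive) {y : ZFSet.{v}} (hy : y ∈ u)
    (p : RawTerm.{v, v + 1} Ordinal.{v} → Prop) :
    (∃ a ∈ baseTerms u y, p a) ↔ ∃ x ∈ y, p (.base x) :=
  ⟨fun ⟨_, ⟨z, _, hzy, e⟩, hp⟩ => ⟨z, hzy, e ▸ hp⟩,
    fun ⟨x, hx, hp⟩ => ⟨_, ⟨x, hu.mem_trans hx hy, hx, rfl⟩, hp⟩⟩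

theorem mem_interp_level (h : γ < α) {x : ZFSet.{v}} :
    x ∈ interp u α (.level γ) ↔ ∃ a ∈ termsBelow u (Set.Iio α) γ, interp u α a = x := by
  rw [interp_level u h, mem_stage, termsBelow_eq h.le]
  exact exists_congr fun a => and_congr_right fun ha => by rw [interp_eq_of_le h.le ha]

/-- The parameters of `φ` and the candidate `a` all denote elements of the transitive stage `γ`, so
absoluteness of the bounded formula `φ` allows passing from stage `γ` to stage `α`. -/
theorem mem_interp_sep (hu : u.IsTransitive) {φ : Formula (RawTerm.{v, v + 1} Ordinal.{v}) 1}
    (hφ : RawTerm.sep γ φ ∈ terms u (Set.Iio α)) {x : ZFSet.{v}} :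
    x ∈ interp u α (.sep γ φ) ↔
      ∃ a ∈ termsBelow u (Set.Iio α) γ, Holds u α (φ.inst a) ∧ interp u α a = x := by
  cases hφ with
  | sep _ h _ hφ hc hlt =>
  replace h : γ < α := h
  have hc' : ∀ c ∈ φ.consts, c ∈ terms u (Set.Iio γ) :=
    fun c hcφ => (hc c hcφ).of_supp_subset (hlt c hcφ)
  rw [interp_sep u h, ZFSet.mem_sep, mem_stage, termsBelow_eq h.le]
  have key : ∀ a ∈ terms u (Set.Iio γ),
      (Holds u α (φ.inst a) ↔ φ.Sat (stage u γ) (interp u γ) fun _ => interp u γ a) := by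
    intro a ha
    rw [Holds, Formula.sat_inst_closed, interp_eq_of_le h.le ha,
      φ.sat_congr (val' := interp u γ) (fun c hcφ => interp_eq_of_le h.le (hc' c hcφ)),
      ← φ.sat_absolute (isTransitive_stage hu γ) (stage_mono h.le) hφ
        (fun c hcφ => interp_mem_stage (hc' c hcφ)) _ (fun _ => interp_mem_stage ha)]
  constructor
  · rintro ⟨⟨a, ha, rfl⟩, hs⟩
    exact ⟨a, ha, (key a ha).2 hs, interp_eq_of_le h.le ha⟩
  · rintro ⟨a, ha, hs, rfl⟩
    rw [interp_eq_of_le h.le ha]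
    exact ⟨⟨a, ha, rfl⟩, (key a ha).1 hs⟩

end stages

/-! ### Correctness of the disjunctive clauses -/

section clauses

variable {u : ZFSet.{v}} {α : Ordinal.{v}}

theorem get_mem_terms {s : Arg (RawTerm.{v, v + 1} Ordinal.{v}) 0}
    (h : s.consts ⊆ terms u (Set.Iio α)) : s.get ∈ terms u (Set.Iio α) :=
  h s.get_mem_consts

theorem exists_binaryFamily_iff (φ₀ φ₁ : Formula (RawTerm.{v, v + 1} Ordinal.{v}) 0)
    (p : Formula (RawTerm.{v, v + 1} Ordinal.{v}) 0 → Prop) :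
    (∃ a ∈ (binaryFamily φ₀ φ₁).index, p ((binaryFamily φ₀ φ₁).component a)) ↔ p φ₀ ∨ p φ₁ := by
  have h : (RawTerm.base {∅} : RawTerm.{v, v + 1} Ordinal.{v}) ≠ .base ∅ :=
    fun e =>
    ZFSet.notMem_empty ∅ ((ZFSet.ext_iff.1 (RawTerm.base.inj e) ∅).1 (ZFSet.mem_singleton.2 rfl))
  simp [binaryFamily, h]

theorem holds_eq_const (a b : RawTerm.{v, v + 1} Ordinal.{v}) :
    Holds u α (.eq (.const a) (.const b)) ↔ interp u α a = interp u α b :=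
  Iff.rfl

theorem holds_and (φ ψ : Formula (RawTerm.{v, v + 1} Ordinal.{v}) 0) :
    Holds u α (.and φ ψ) ↔ Holds u α φ ∧ Holds u α ψ :=
  Iff.rfl

theorem holds_neg (φ : Formula (RawTerm.{v, v + 1} Ordinal.{v}) 0) :
    Holds u α φ.neg ↔ ¬ Holds u α φ :=
  φ.sat_neg _

theorem memClause_correct (hu : u.IsTransitive) {b c : RawTerm.{v, v + 1} Ordinal.{v}}
    (hc : c ∈ terms u (Set.Iio α)) {f : Family.{v, v + 1} Ordinal.{v}}
    (hf : memClause u (Set.Iio α) b c = some f) :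
    interp u α b ∈ interp u α c ↔ ∃ a ∈ f.index, Holds u α (f.component a) := by
  cases hc with
  | base y hy =>
    cases b with
    | base z =>
      simp only [memClause] at hf
      split_ifs at hf with hz
      obtain rfl := Option.some.inj hf
      simp [emptyFamily, interp_base, hz]
    | level s =>
      obtain rfl := Option.some.inj hf
      simp only [exists_base_iff hu hy, holds_eq_const, interp_base, exists_eq_right]
    | sep s φ =>
      obtain rfl := Option.some.inj hf
      simp only [exists_base_iff hu hy, holds_eq_const, interp_base, exists_eq_right]
  | level s hs =>
    obtain rfl := Option.some.inj hf
    exact mem_interp_level hs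
  | sep s hs φ hφ hcφ hlt =>
    obtain rfl := Option.some.inj hf
    exact mem_interp_sep hu (.sep s hs φ hφ hcφ hlt)

theorem exInClause_correct (hu : u.IsTransitive) (ψ : Formula (RawTerm.{v, v + 1} Ordinal.{v}) 1)
    {c : RawTerm.{v, v + 1} Ordinal.{v}} (hc : c ∈ terms u (Set.Iio α)) :
    (∃ x ∈ interp u α c, ψ.Sat (stage u α) (interp u α) fun _ => x) ↔
      ∃ a ∈ (exInClause u (Set.Iio α) ψ c).index,
        Holds u α ((exInClause u (Set.Iio α) ψ c).component a) := by
  cases hc with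
  | base y hy =>
    simp only [exInClause, exists_base_iff hu hy, Holds, Formula.sat_inst_closed, interp_base]
  | level s hs =>
    simp only [exInClause, mem_interp_level hs, Holds, Formula.sat_inst_closed]
    exact ⟨fun ⟨_, ⟨a, ha, e⟩, h⟩ => ⟨a, ha, e ▸ h⟩, fun ⟨a, ha, h⟩ => ⟨_, ⟨a, ha, rfl⟩, h⟩⟩
  | sep s hs φ hφ hcφ hlt =>
    simp only [exInClause, mem_interp_sep hu (.sep s hs φ hφ hcφ hlt), holds_and]
    constructor
    · rintro ⟨_, ⟨a, ha, hφa, rfl⟩, h⟩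
      exact ⟨a, ha, hφa, (Formula.sat_inst_closed a ψ).2 h⟩
    · rintro ⟨a, ha, hφa, h⟩
      exact ⟨_, ⟨a, ha, hφa, rfl⟩, (Formula.sat_inst_closed a ψ).1 h⟩

/-- Transitivity of the stage makes the restriction of the quantifier to the stage redundant. -/
theorem holds_exIn_iff (hu : u.IsTransitive) {b : Arg (RawTerm.{v, v + 1} Ordinal.{v}) 0}
    (hb : b.get ∈ terms u (Set.Iio α)) (ψ : Formula (RawTerm.{v, v + 1} Ordinal.{v}) 1) :
    Holds u α (.exIn b ψ) ↔
      ∃ x ∈ interp u α b.get, ψ.Sat (stage u α) (interp u α) fun _ => x := by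
  simp only [Holds, Formula.Sat, Formula.snoc_elim0, Arg.eval_get]
  exact ⟨fun ⟨x, _, h⟩ => ⟨x, h⟩,
    fun ⟨x, hx, h⟩ => ⟨x, (isTransitive_stage hu α).mem_trans hx (interp_mem_stage hb), hx, h⟩⟩

/-- A disjunctive formula is equivalent to the disjunction of its components. -/
theorem disjunction_correct (hu : u.IsTransitive) {φ : Formula (RawTerm.{v, v + 1} Ordinal.{v}) 0}
    (hφ : φ ∈ closedFormulas u (Set.Iio α)) {f : Family.{v, v + 1} Ordinal.{v}}
    (hf : disjunction u (Set.Iio α) φ = some f) :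
    Holds u α φ ↔ ∃ a ∈ f.index, Holds u α (f.component a) := by
  cases φ with
  | mem b c =>
    have hc := get_mem_terms fun _ h => hφ (Or.inr h)
    rw [← memClause_correct hu hc hf, Holds, Formula.Sat, Arg.eval_get, Arg.eval_get]
  | notMem b c =>
    rw [Holds, Formula.Sat, Arg.eval_get, Arg.eval_get]
    simp only [disjunction] at hf
    revert hf
    -- Only two base terms `z ∈ y` give a disjunctive formula here; it is false and its disjunction
    -- is empty.
    cases b.get <;> cases c.get <;> simp only [notMemClause] <;> try simp
    intro hz hf
    subst hf
    simp [emptyFamily, interp_base, hz]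
  | ne b c =>
    have hb := get_mem_terms fun _ h => hφ (Or.inl h)
    have hc := get_mem_terms fun _ h => hφ (Or.inr h)
    obtain rfl := Option.some.inj hf
    rw [exists_binaryFamily_iff, holds_exIn_iff hu (b := .const _) hb,
      holds_exIn_iff hu (b := .const _) hc, Holds, Formula.Sat, Arg.eval_get, Arg.eval_get]
    simp only [Formula.Sat, Arg.eval, Arg.get]
    -- By extensionality, the sets differ if and only if some element lies in exactly one of them.
    rw [Ne, ZFSet.ext_iff, not_forall]
    simp only [← exists_or]
    exact exists_congr fun x => by tauto
  | or ψ₀ ψ₁ =>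
    obtain rfl := Option.some.inj hf
    rw [exists_binaryFamily_iff]
    rfl
  | exIn b ψ =>
    have hb := get_mem_terms fun _ h => hφ (Or.inl h)
    obtain rfl := Option.some.inj hf
    rw [← exInClause_correct hu ψ hb, holds_exIn_iff hu hb]
  | ex ψ =>
    obtain rfl := Option.some.inj hf
    simp only [Holds, Formula.Sat, Formula.snoc_elim0, mem_stage, Formula.sat_inst_closed]
    exact ⟨fun ⟨_, ⟨a, ha, e⟩, h⟩ => ⟨a, ha, e ▸ h⟩, fun ⟨a, ha, h⟩ => ⟨_, ⟨a, ha, rfl⟩, h⟩⟩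
  | eq | and | allIn | all => simp [disjunction] at hf

end clauses

/-! ### A rank that decreases from formulas to their components -/

section rank

/-- The least ordinal `γ` such that a (well-formed) term lies in `𝐋^u_γ`. -/
def height : RawTerm.{v, v + 1} Ordinal.{v} → Ordinal.{v}
  | .base _ => 0
  | .level s => s + 1
  | .sep s _ => s + 1

/-- The height of an argument, where variables count as elements of `u`. -/
def Arg.height {n : ℕ} : Arg (RawTerm.{v, v + 1} Ordinal.{v}) n → Ordinal.{v}
  | .var _ => 0
  | .const c => ConstructibleTerms.height c

open Classical in
/-- The rank of `b ∈ c` for terms of height `β` and `γ`, respectively. -/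
noncomputable def memRank (β γ : Ordinal.{v}) : Ordinal.{v} :=
  if γ ≤ β ∧ 0 < β then ω * β + 5 else ω * γ

/-- The rank of formulas. -/
noncomputable def Formula.rank (α : Ordinal.{v}) :
    {n : ℕ} → Formula (RawTerm.{v, v + 1} Ordinal.{v}) n → Ordinal.{v}
  | _, mem s t => memRank s.height t.height
  | _, notMem s t => memRank s.height t.height
  | _, eq s t => ω * max s.height t.height + 3
  | _, ne s t => ω * max s.height t.height + 3
  | _, and φ ψ => max (φ.rank α) (ψ.rank α) + 1
  | _, or φ ψ => max (φ.rank α) (ψ.rank α) + 1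
  | _, allIn t φ => max (ω * t.height) (φ.rank α) + 2
  | _, exIn t φ => max (ω * t.height) (φ.rank α) + 2
  | _, all φ => max (ω * (α + 1)) (φ.rank α) + 1
  | _, ex φ => max (ω * (α + 1)) (φ.rank α) + 1

variable {α : Ordinal.{v}}

/-- This absorbs all finite syntactic increments once the height drops. -/
theorem omega0_mul_add_lt {β γ : Ordinal.{v}} (h : β < γ) (n : ℕ) : ω * β + n < ω * γ :=
  calc ω * β + n < ω * β + ω := by gcongr; exact natCast_lt_omega0 n
    _ = ω * (β + 1) := (mul_add_one _ _).symm
    _ ≤ ω * γ := by gcongr; exact Order.add_one_le_of_lt h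

theorem height_le_of_supp {u : ZFSet.{v}} {S : Set Ordinal.{v}}
    {a : RawTerm.{v, v + 1} Ordinal.{v}} (ha : IsTerm u S a) {γ : Ordinal.{v}}
    (h : ∀ t ∈ supp a, t < γ) : height a ≤ γ := by
  cases ha with
  | base => exact zero_le
  | level s => exact Order.add_one_le_of_lt (h s (.level s))
  | sep s _ φ => exact Order.add_one_le_of_lt (h s (.sep s φ))

theorem memRank_zero_left (γ : Ordinal.{v}) : memRank 0 γ = ω * γ := by
  simp [memRank]

theorem le_memRank (β γ : Ordinal.{v}) : ω * γ ≤ memRank β γ := by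
  unfold memRank
  split_ifs with h
  · exact (mul_le_mul_right h.1 _).trans le_self_add
  · exact le_rfl

theorem memRank_le_max (β γ : Ordinal.{v}) : memRank β γ ≤ ω * max β γ + 5 := by
  unfold memRank
  split_ifs
  · gcongr; exact le_max_left _ _
  · exact (mul_le_mul_right (le_max_right _ _) _).trans le_self_add

/-- Handles `a = b` as a component of `b ∈ c`, where `δ`, `β`, `γ` are the heights of `a`, `b`, `c`.
The `+ 1` pays for the conjunction in the separation clause, which is why `memRank` uses 5. The
second alternative covers `c ∈ u`, where `a` has height 0. -/
theorem eq_rank_lt_memRank {β γ δ : Ordinal.{v}} (h : δ < γ ∨ δ = 0 ∧ 0 < β) :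
    ω * max δ β + 3 + 1 < memRank β γ := by
  have e : ω * max δ β + 3 + 1 = ω * max δ β + (4 : ℕ) := by
    rw [add_assoc]; norm_num
  rw [e]
  unfold memRank
  split_ifs with hβ
  · have : δ ≤ β := by
      rcases h with h | h
      · exact h.le.trans hβ.1
      · rw [h.1]; exact zero_le
    rw [max_eq_right this]
    gcongr
    exact_mod_cast (by norm_num : (4 : ℕ) < 5)
  · apply omega0_mul_add_lt
    rcases h with h | h
    · refine max_lt h ?_
      by_contra! hβ'
      exact hβ ⟨hβ', (zero_le).trans_lt (h.trans_le hβ')⟩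
    · rw [h.1, max_eq_right (zero_le)]
      by_contra! hβ'
      exact hβ ⟨hβ', h.2⟩

namespace Formula

theorem rank_neg {n : ℕ} (φ : Formula (RawTerm.{v, v + 1} Ordinal.{v}) n) :
    φ.neg.rank α = φ.rank α := by
  induction φ <;> simp_all [neg, rank]

end Formula

/-! ### Effect of substitution on heights and ranks -/

theorem Arg.height_ofFin {n : ℕ} (i : Fin n) :
    (Arg.ofFin i : Arg (RawTerm.{v, v + 1} Ordinal.{v}) n).height = 0 := by
  cases n with
  | zero => exact i.elim0
  | succ n => rfl

theorem Arg.height_inst (a : RawTerm.{v, v + 1} Ordinal.{v}) {n : ℕ}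
    (s : Arg (RawTerm.{v, v + 1} Ordinal.{v}) (n + 1)) :
    (s.inst a).height = s.height ∨ s.height = 0 ∧ (s.inst a).height = ConstructibleTerms.height a := by
  cases s with
  | const d => exact Or.inl rfl
  | var i =>
    refine Fin.cases (Or.inr ⟨rfl, rfl⟩) (fun j => Or.inl ?_) i
    exact Arg.height_ofFin j

theorem Arg.height_inst_of_height_eq_zero {a : RawTerm.{v, v + 1} Ordinal.{v}}
    (ha : ConstructibleTerms.height a = 0) {n : ℕ}
    (s : Arg (RawTerm.{v, v + 1} Ordinal.{v}) (n + 1)) : (s.inst a).height = s.height := by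
  rcases s.height_inst a with h | h
  · exact h
  · rw [h.1, h.2, ha]

theorem Arg.height_inst_le (a : RawTerm.{v, v + 1} Ordinal.{v}) {n : ℕ}
    (s : Arg (RawTerm.{v, v + 1} Ordinal.{v}) (n + 1)) :
    (s.inst a).height ≤ max s.height (ConstructibleTerms.height a) := by
  rcases s.height_inst a with h | h
  · exact h ▸ le_max_left _ _
  · exact h.2 ▸ le_max_right _ _

theorem omega0_mul_max_add_le (β γ : Ordinal.{v}) (n : ℕ) :
    ω * max β γ + n ≤ max (ω * β + n) (ω * γ + n) := by
  rcases max_choice β γ with h | h <;> rw [h]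
  · exact le_max_left _ _
  · exact le_max_right _ _

theorem memRank_inst_le (a : RawTerm.{v, v + 1} Ordinal.{v}) {n : ℕ}
    (s t : Arg (RawTerm.{v, v + 1} Ordinal.{v}) (n + 1)) :
    memRank (s.inst a).height (t.inst a).height ≤
      max (memRank s.height t.height) (ω * height a + (5 : ℕ)) := by
  by_cases h : max (s.inst a).height (t.inst a).height ≤ height a
  · exact le_max_of_le_right ((memRank_le_max _ _).trans (by push_cast; gcongr))
  refine le_max_of_le_left ?_
  -- The larger instantiated height now exceeds `height a`, so that argument is unchanged by the
  -- substitution. If it is on the left, both ranks fall under the first case of `memRank` and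
  -- agree; otherwise the right side alone determines the new rank.
  push Not at h
  have e : ∀ s : Arg (RawTerm.{v, v + 1} Ordinal.{v}) (n + 1), height a < (s.inst a).height →
      (s.inst a).height = s.height := fun s h =>
    (s.height_inst a).resolve_right fun h' => h.ne' h'.2
  have hle : ∀ s : Arg (RawTerm.{v, v + 1} Ordinal.{v}) (n + 1), s.height ≤ (s.inst a).height :=
    fun s => (s.height_inst a).elim (fun h => h.ge) fun h => h.1 ▸ zero_le
  by_cases hts : (t.inst a).height ≤ (s.inst a).height
  · rw [max_eq_left hts] at h
    have hs := e s h
    have hpos : 0 < s.height := hs ▸ (zero_le).trans_lt h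
    rw [memRank, memRank, if_pos ⟨hts, hs ▸ hpos⟩,
      if_pos ⟨(hle t).trans (hts.trans hs.le), hpos⟩, hs]
  · rw [memRank, if_neg fun h => hts h.1, e t (by rwa [max_eq_right (not_le.1 hts).le] at h)]
    exact le_memRank _ _

namespace Formula

theorem max_add_le_of_le {x y x' y' z : Ordinal.{v}} {m n k l : ℕ}
    (hx : x' ≤ max x (z + m)) (hy : y' ≤ max y (z + n)) (hl : max m n + k ≤ l) :
    max x' y' + k ≤ max (max x y + k) (z + l) := by
  have key : ∀ {w w' : Ordinal.{v}} {i : ℕ}, w' ≤ max w (z + i) → w ≤ max x y → i ≤ max m n →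
      w' + k ≤ max (max x y + k) (z + l) := by
    intro w w' i h hw hi
    rcases le_max_iff.1 h with h | h
    · exact le_max_of_le_left (by gcongr; exact h.trans hw)
    · refine le_max_of_le_right ?_
      calc w' + k ≤ z + i + k := by gcongr
        _ = z + (i + k : ℕ) := by rw [add_assoc, Nat.cast_add]
        _ ≤ z + l := by gcongr; omega
  rcases max_choice x' y' with h | h <;> rw [h]
  · exact key hx (le_max_left _ _) (le_max_left _ _)
  · exact key hy (le_max_right _ _) (le_max_right _ _)

/-- Substitution can increase the rank only through occurrences where `a` dominates, and these
contribute `ω * height a` plus a finite amount determined by the syntax of `φ`. -/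
theorem rank_inst_le : ∀ {n : ℕ} (φ : Formula (RawTerm.{v, v + 1} Ordinal.{v}) (n + 1)),
    ∃ N : ℕ, ∀ a, (φ.inst a).rank α ≤ max (φ.rank α) (ω * height a + N)
  | _, mem s t => ⟨5, fun a => by simpa only [inst, rank] using memRank_inst_le a s t⟩
  | _, notMem s t => ⟨5, fun a => by simpa only [inst, rank] using memRank_inst_le a s t⟩
  | _, eq s t | _, ne s t => ⟨3, fun a => by
      refine le_trans ?_ (omega0_mul_max_add_le _ _ 3)
      simp only [inst, rank]
      push_cast
      gcongr ω * ?_ + _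
      exact max_le ((s.height_inst_le a).trans (max_le_max_right _ (le_max_left _ _)))
        ((t.height_inst_le a).trans (max_le_max_right _ (le_max_right _ _)))⟩
  | _, and φ ψ | _, or φ ψ => by
      obtain ⟨M, hM⟩ := rank_inst_le φ
      obtain ⟨N, hN⟩ := rank_inst_le ψ
      refine ⟨max M N + 1, fun a => ?_⟩
      have := max_add_le_of_le (k := 1) (hM a) (hN a) le_rfl
      simpa only [inst, rank, Nat.cast_one] using this
  | _, allIn t φ | _, exIn t φ => by
      obtain ⟨N, hN⟩ := rank_inst_le φ
      refine ⟨max 0 N + 2, fun a => ?_⟩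
      have ht : ω * (t.inst a).height ≤ max (ω * t.height) (ω * height a + (0 : ℕ)) := by
        rcases t.height_inst a with h | h
        · rw [h]; exact le_max_left _ _
        · rw [h.2, Nat.cast_zero, add_zero]; exact le_max_right _ _
      have := max_add_le_of_le (k := 2) ht (hN a) le_rfl
      simpa only [inst, rank, Nat.cast_ofNat] using this
  | _, all φ | _, ex φ => by
      obtain ⟨N, hN⟩ := rank_inst_le φ
      refine ⟨max 0 N + 1, fun a => ?_⟩
      have := max_add_le_of_le (k := 1) (m := 0) (z := ω * height a)
        (le_max_left (ω * (α + 1)) _) (hN a) le_rfl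
      simpa only [inst, rank, Nat.cast_one] using this

/-- Needed for quantifiers bounded by `v ∈ u`: there the bound has height 0 and leaves no room to
absorb a finite increase. -/
theorem rank_inst_of_height_eq_zero {a : RawTerm.{v, v + 1} Ordinal.{v}} (ha : height a = 0) :
    ∀ {n : ℕ} (φ : Formula (RawTerm.{v, v + 1} Ordinal.{v}) (n + 1)),
      (φ.inst a).rank α = φ.rank α
  | _, mem s t | _, notMem s t | _, eq s t | _, ne s t => by
    simp only [inst, rank, Arg.height_inst_of_height_eq_zero ha]
  | _, and φ ψ | _, or φ ψ => by
    simp only [inst, rank, rank_inst_of_height_eq_zero ha φ, rank_inst_of_height_eq_zero ha ψ]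
  | _, allIn t φ | _, exIn t φ => by
    simp only [inst, rank, rank_inst_of_height_eq_zero ha φ, Arg.height_inst_of_height_eq_zero ha]
  | _, all φ | _, ex φ => by simp only [inst, rank, rank_inst_of_height_eq_zero ha φ]

theorem _root_.ConstructibleTerms.Arg.height_le {γ : Ordinal.{v}} {n : ℕ}
    (s : Arg (RawTerm.{v, v + 1} Ordinal.{v}) n)
    (hc : ∀ c ∈ s.consts, ConstructibleTerms.height c ≤ γ) : s.height ≤ γ := by
  cases s with
  | var i => exact zero_le
  | const c => exact hc c rfl

/-- Boundedness is essential, as an unbounded quantifier contributes `ω * (α + 1)`. -/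
theorem rank_le_of_isBounded {γ : Ordinal.{v}} {n : ℕ}
    (φ : Formula (RawTerm.{v, v + 1} Ordinal.{v}) n) (hφ : φ.IsBounded)
    (hc : ∀ c ∈ φ.consts, height c ≤ γ) : ∃ N : ℕ, φ.rank α ≤ ω * γ + N := by
  induction φ with
  | mem s t | notMem s t =>
    refine ⟨5, (memRank_le_max _ _).trans ?_⟩
    push_cast
    gcongr
    exact max_le (s.height_le fun c h => hc c (Or.inl h)) (t.height_le fun c h => hc c (Or.inr h))
  | eq s t | ne s t =>
    refine ⟨3, ?_⟩
    simp only [rank]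
    push_cast
    gcongr
    exact max_le (s.height_le fun c h => hc c (Or.inl h)) (t.height_le fun c h => hc c (Or.inr h))
  | and φ ψ ih₁ ih₂ | or φ ψ ih₁ ih₂ =>
    obtain ⟨M, hM⟩ := ih₁ hφ.1 fun c h => hc c (Or.inl h)
    obtain ⟨N, hN⟩ := ih₂ hφ.2 fun c h => hc c (Or.inr h)
    refine ⟨max M N + 1, ?_⟩
    rw [rank, Nat.cast_add, ← add_assoc, Nat.cast_one]
    gcongr
    refine max_le (hM.trans ?_) (hN.trans ?_) <;> gcongr
    · exact le_max_left _ _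
    · exact le_max_right _ _
  | allIn t φ ih | exIn t φ ih =>
    obtain ⟨N, hN⟩ := ih hφ fun c h => hc c (Or.inr h)
    refine ⟨N + 2, ?_⟩
    rw [rank, Nat.cast_add, ← add_assoc, Nat.cast_ofNat]
    gcongr
    refine max_le (le_trans ?_ le_self_add) hN
    gcongr
    exact t.height_le fun c h => hc c (Or.inl h)
  | all φ ih | ex φ ih => exact hφ.elim

end Formula

/-! ### Descent of the rank to components -/

variable {u : ZFSet.{v}}

/-- Parameters and `a` have height at most `γ`, while the separation term has height `γ + 1`; the
gap of `ω` absorbs the syntax of `φ` and the enclosing conjunction. -/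
theorem rank_inst_sep_le {γ : Ordinal.{v}} {φ : Formula (RawTerm.{v, v + 1} Ordinal.{v}) 1}
    (hφ : RawTerm.sep γ φ ∈ terms u (Set.Iio α)) {a : RawTerm.{v, v + 1} Ordinal.{v}}
    (ha : height a ≤ γ) : (φ.inst a).rank α + 1 < ω * (γ + 1) := by
  cases hφ with
  | sep _ _ _ hφ hc hlt =>
  obtain ⟨M, hM⟩ := φ.rank_le_of_isBounded (α := α) hφ
    fun c h => height_le_of_supp (hc c h) (hlt c h)
  obtain ⟨N, hN⟩ := φ.rank_inst_le (α := α)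
  refine lt_of_le_of_lt ?_ (omega0_mul_add_lt (lt_add_one γ) (max M N + 1))
  rw [Nat.cast_add, ← add_assoc, Nat.cast_one]
  gcongr
  refine (hN a).trans (max_le (hM.trans ?_) ?_) <;> gcongr
  · exact le_max_left _ _
  · exact le_max_right _ _

theorem max_add_one_lt {x y z : Ordinal.{v}} (hx : x + 1 < z) (hy : y + 1 < z) :
    max x y + 1 < z := by
  rcases max_choice x y with h | h <;> rwa [h]

theorem rank_memClause_lt {b c : RawTerm.{v, v + 1} Ordinal.{v}}
    (hc : c ∈ terms u (Set.Iio α)) {f : Family.{v, v + 1} Ordinal.{v}}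
    (hf : memClause u (Set.Iio α) b c = some f) {a : RawTerm.{v, v + 1} Ordinal.{v}}
    (ha : a ∈ f.index) : (f.component a).rank α < memRank (height b) (height c) := by
  cases hc with
  | base y hy =>
    cases b with
    | base z =>
      simp only [memClause] at hf
      split_ifs at hf with hz
      obtain rfl := Option.some.inj hf
      exact ha.elim
    | level s | sep s φ =>
      obtain rfl := Option.some.inj hf
      obtain ⟨z, _, _, rfl⟩ := ha
      exact (lt_add_one _).trans
        (eq_rank_lt_memRank (Or.inr ⟨rfl, (zero_le).trans_lt (lt_add_one s)⟩))
  | level s hs =>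
    obtain rfl := Option.some.inj hf
    have := height_le_of_supp ha.1 ha.2
    exact (lt_add_one _).trans
      (eq_rank_lt_memRank (Or.inl (this.trans_lt (lt_add_one s))))
  | sep s hs φ hφ hcφ hlt =>
    obtain rfl := Option.some.inj hf
    have := height_le_of_supp ha.1 ha.2
    refine max_add_one_lt ?_ (eq_rank_lt_memRank (Or.inl (this.trans_lt (lt_add_one s))))
    exact (rank_inst_sep_le (.sep s hs φ hφ hcφ hlt) this).trans_le (le_memRank _ _)

theorem rank_exInClause_lt (ψ : Formula (RawTerm.{v, v + 1} Ordinal.{v}) 1)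
    {c : RawTerm.{v, v + 1} Ordinal.{v}} (hc : c ∈ terms u (Set.Iio α))
    {a : RawTerm.{v, v + 1} Ordinal.{v}} (ha : a ∈ (exInClause u (Set.Iio α) ψ c).index) :
    ((exInClause u (Set.Iio α) ψ c).component a).rank α <
      max (ω * height c) (ψ.rank α) + 2 := by
  obtain ⟨N, hN⟩ := ψ.rank_inst_le (α := α)
  have two : ∀ x : Ordinal.{v}, x + 2 = x + 1 + 1 := fun x => by rw [add_assoc, one_add_one_eq_two]
  have below : ∀ s, height a ≤ s →
      (ψ.inst a).rank α ≤ max (ω * (s + 1)) (ψ.rank α) := fun s h =>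
    (hN a).trans (max_le (le_max_right _ _)
      (le_max_of_le_left (omega0_mul_add_lt (h.trans_lt (lt_add_one s)) N).le))
  -- Of the increment 2, one unit gives strictness and the other pays for the conjunction in the
  -- separation clause.
  rw [two, Order.lt_add_one_iff]
  cases hc with
  | base y hy =>
    obtain ⟨z, _, _, rfl⟩ := ha
    exact (ψ.rank_inst_of_height_eq_zero rfl).le.trans ((le_max_right _ _).trans le_self_add)
  | level s hs =>
    exact (below s (height_le_of_supp ha.1 ha.2)).trans le_self_add
  | sep s hs φ hφ hcφ hlt =>
    have h := height_le_of_supp ha.1 ha.2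
    simp only [exInClause, Formula.rank]
    gcongr ?_ + _
    exact max_le (le_max_of_le_left (le_self_add.trans
      (rank_inst_sep_le (.sep s hs φ hφ hcφ hlt) h).le)) (below s h)

/-- The components of a disjunctive formula have smaller rank. -/
theorem rank_component_lt {φ : Formula (RawTerm.{v, v + 1} Ordinal.{v}) 0}
    (hφ : φ ∈ closedFormulas u (Set.Iio α)) {f : Family.{v, v + 1} Ordinal.{v}}
    (hf : disjunction u (Set.Iio α) φ = some f) {a : RawTerm.{v, v + 1} Ordinal.{v}}
    (ha : a ∈ f.index) : (f.component a).rank α < φ.rank α := by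
  have get : ∀ s : Arg (RawTerm.{v, v + 1} Ordinal.{v}) 0, s.height = height s.get := by
    rintro ⟨⟩; rfl
  have binary : ∀ {φ₀ φ₁ : Formula (RawTerm.{v, v + 1} Ordinal.{v}) 0} {x : Ordinal.{v}},
      φ₀.rank α < x → φ₁.rank α < x → ((binaryFamily φ₀ φ₁).component a).rank α < x := by
    intro φ₀ φ₁ x h₀ h₁
    unfold binaryFamily
    dsimp only
    split_ifs
    exacts [h₀, h₁]
  cases φ with
  | mem b c =>
    have hc := get_mem_terms fun _ h => hφ (Or.inr h)
    rw [Formula.rank, get, get]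
    exact rank_memClause_lt hc hf ha
  | notMem b c =>
    simp only [disjunction] at hf
    revert hf
    cases b.get <;> cases c.get <;> simp only [notMemClause] <;> try simp
    rintro hz rfl
    exact ha.elim
  | ne b c =>
    obtain rfl := Option.some.inj hf
    -- The 0 is the height of the bound variable in `x ∉ b`; the quantifier adds 2, which the 3 in
    -- the rank of inequations exceeds.
    have key : ∀ x y : Ordinal.{v}, max (ω * x) (memRank 0 y) + 2 < ω * max x y + 3 := by
      intro x y
      rw [memRank_zero_left]
      refine lt_of_le_of_lt (b := ω * max x y + 2) ?_ ?_
      · gcongr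
        exact max_le (mul_le_mul_right (le_max_left _ _) _) (mul_le_mul_right (le_max_right _ _) _)
      · gcongr
        exact_mod_cast (by norm_num : (2 : ℕ) < 3)
    refine binary ?_ ?_
    · rw [Formula.rank, Formula.rank, Formula.rank, get b, get c]
      exact key _ _
    · rw [Formula.rank, Formula.rank, Formula.rank, get b, get c, max_comm (height b.get)]
      exact key _ _
  | or ψ₀ ψ₁ =>
    obtain rfl := Option.some.inj hf
    exact binary (Order.lt_add_one_iff.2 (le_max_left _ _))
      (Order.lt_add_one_iff.2 (le_max_right _ _))
  | exIn b ψ =>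
    have hb := get_mem_terms fun _ h => hφ (Or.inl h)
    obtain rfl := Option.some.inj hf
    rw [Formula.rank, get]
    exact rank_exInClause_lt ψ hb ha
  | ex ψ =>
    obtain rfl := Option.some.inj hf
    obtain ⟨N, hN⟩ := ψ.rank_inst_le (α := α)
    -- Equality can occur for successor `α`, hence the `α + 1` in the rank of unbounded quantifiers.
    have h : height a ≤ α := height_le_of_supp ha ha.supp_subset
    refine Order.lt_add_one_iff.2 ((hN a).trans (max_le (le_max_right _ _) (le_max_of_le_left ?_)))
    exact (omega0_mul_add_lt (h.trans_lt (lt_add_one α)) N).le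
  | eq | and | allIn | all => simp [disjunction] at hf

end rank

end ConstructibleTerms

/-! ### Conclusion by induction on the rank -/

theorem mainTheorem8 (u : ZFSet.{v}) (hu : u.IsTransitive) (h0 : ∅ ∈ u) (h1 : {∅} ∈ u)
    (α : Ordinal.{v})
    (F : Set (ConstructibleTerms.Formula (ConstructibleTerms.RawTerm.{v, v + 1} Ordinal.{v}) 0))
    (hF : F ⊆ ConstructibleTerms.closedFormulas u (Set.Iio α))
    (hconj : ∀ φ ∈ F, ∀ f, ConstructibleTerms.conjunction u (Set.Iio α) φ = some f →
      ∃ a ∈ f.index, f.component a ∈ F)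
    (hdisj : ∀ φ ∈ F, ∀ f, ConstructibleTerms.disjunction u (Set.Iio α) φ = some f →
      ∀ a ∈ f.index, f.component a ∈ F) :
    ∀ φ ∈ F, ¬ ConstructibleTerms.Holds u α φ := by

  intro φ
  induction hr : φ.rank α using WellFoundedLT.induction generalizing φ with
  | ind r ih =>
  subst hr
  intro hφ hholds
  cases hd : ConstructibleTerms.disjunction u (Set.Iio α) φ with
  | some f =>
    obtain ⟨a, ha, h⟩ := (ConstructibleTerms.disjunction_correct hu (hF hφ) hd).1 hholds
    exact ih _ (ConstructibleTerms.rank_component_lt (hF hφ) hd ha) _ rfl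
      (hdisj φ hφ f hd a ha) h
  | none =>
    obtain ⟨g, hg⟩ := Option.isSome_iff_exists.1
      ((ConstructibleTerms.conjunction_isSome_iff u (Set.Iio α) φ).2 hd)
    obtain ⟨a, ha, haF⟩ := hconj φ hφ g hg
    obtain ⟨f, hf, rfl⟩ := Option.map_eq_some_iff.1 hg
    have hneg : φ.neg ∈ ConstructibleTerms.closedFormulas u (Set.Iio α) :=
      φ.consts_neg.subset.trans (hF hφ)
    have hlt := ConstructibleTerms.rank_component_lt hneg hf ha
    -- The component of `φ` in `F` is the negation of a component of `¬φ`; invariance under negation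
    -- transfers the descent.
    rw [φ.rank_neg, ← (f.component a).rank_neg] at hlt
    refine ih _ hlt _ rfl haF ((ConstructibleTerms.holds_neg _).2 fun h => ?_)
    exact (ConstructibleTerms.holds_neg φ).1
      ((ConstructibleTerms.disjunction_correct hu hneg hf).2 ⟨a, ha, h⟩) hholds
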